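/- Let $k,l,g,h\in\mathbb{N}_0$ and let $\Omega=[a,b]\times[c,d]$ with extended clamped knot sequences $$\lambda_{-k}=\cdots=\lambda_0=a<\lambda_1<\cdots<\lambda_g<b=\lambda_{g+1}=\cdots=\lambda_{g+k+1},$$ $$\mu_{-l}=\cdots=\mu_0=c<\mu_1<\cdots<\mu_h<d=\mu_{h+1}=\cdots=\mu_{h+l+1}.$$ Let $\mathcal{S}_k([a,b])$ be the space of univariate splines of degree $k$ with these knots: functions on $[a,b]$ that on each knot interval $[\lambda_j,\lambda_{j+1})$, $0\le j<g$, and on $[\lambda_g,b]$ are polynomials of degree at most $k$, with continuous derivatives of orders $0,\dots,k-1$ at the interior knots (no condition if $k=0$); define $\mathcal{S}_l([c,d])$ likewise. Let $\mathcal{S}_{kl}(\Omega)$ be the space of tensor-product splines, spanned by the products $s(x)t(y)$ with $s\in\mathcal{S}_k([a,b])$, $t\in\mathcal{S}_l([c,d])$, and let $\mathcal{Z}_{kl}(\Omega)=\{s\in\mathcal{S}_{kl}(\Omega):\iint_\Omega s\,dx\,dy=0\}$. For $i=-k,\dots,g-1$ let $Z_i^{k+1}(x)=\frac{d}{dx}B_i^{k+2}(x)$,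 where $B_i^{k+2}$ is the normalized B-spline of degree $k+1$ with knots $\lambda_i,\dots,\lambda_{i+k+2}$ (given by the Cox–de Boor recursion; the derivative is taken from the right on $[a,b)$ and from the left at $b$), and for $j=-l,\dots,h-1$ define $Z_j^{l+1}(y)$ likewise from the knots $\mu$. Then the functions on $\Omega$ $$Z_i^{k+1}(x)\,Z_j^{l+1}(y),\qquad Z_i^{k+1}(x),\qquad Z_j^{l+1}(y),\qquad i=-k,\dots,g-1,\ j=-l,\dots,h-1,$$ form a basis of $\mathcal{Z}_{kl}(\Omega)$, and $$\dim\mathcal{Z}_{kl}(\Omega)=(g+k+1)(h+l+1)-1=(g+k)(h+l)+g+k+h+l.$$ -/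

import Mathlib

open MeasureTheory Polynomial

noncomputable section

/-- An extended clamped knot sequence for degree `k` with `g` interior knots on `[a, b]`:
`λ_{-k} = ⋯ = λ_0 = a < λ_1 < ⋯ < λ_g < b = λ_{g+1} = ⋯ = λ_{g+k+1}`.
Values of `knot` outside `-k, …, g+k+1` are never used. -/
structure ClampedKnots (k g : ℕ) (a b : ℝ) where
  knot : ℤ → ℝ
  left : ∀ i : ℤ, -(k : ℤ) ≤ i → i ≤ 0 → knot i = a
  strictMono : StrictMonoOn knot (Set.Icc (0 : ℤ) ((g : ℤ) + 1))
  right : ∀ i : ℤ, (g : ℤ) + 1 ≤ i → i ≤ (g : ℤ) + k + 1 → knot i = b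

namespace ClampedKnots

variable {k g : ℕ} {a b : ℝ}

/-- The knot interval `[λ_i, λ_{i+1})`, with the right endpoint added when it is nondegenerate
and ends at `b`, so that the knot intervals partition `[a, b]`. -/
def cell (T : ClampedKnots k g a b) (i : ℤ) : Set ℝ :=
  Set.Ico (T.knot i) (T.knot (i + 1)) ∪ (Set.Ioc (T.knot i) (T.knot (i + 1)) ∩ {b})

/-- `T.bSpline m i` is the normalized B-spline of degree `m` (order `m + 1`) with knots
`λ_i, …, λ_{i+m+1}`, by the Cox–de Boor recursion; quotients with denominator zero are zero. -/
def bSpline (T : ClampedKnots k g a b) : ℕ → ℤ → ℝ → ℝ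
  | 0, i => (T.cell i).indicator 1
  | m + 1, i => fun x =>
      (x - T.knot i) / (T.knot (i + m + 1) - T.knot i) * T.bSpline m i x +
      (T.knot (i + m + 2) - x) / (T.knot (i + m + 2) - T.knot (i + 1)) * T.bSpline m (i + 1) x

/-- The ZB-spline of degree `k` on `[a, b]`: the derivative of the B-spline of degree `k + 1` with
knots `λ_i, …, λ_{i+k+2}`. At `b` it is the derivative from the left and elsewhere the derivative
from the right. The side matters only at the endpoints and, if `k = 0`, at interior knots. -/
def zbSpline (T : ClampedKnots k g a b) (i : ℤ) : Set.Icc a b → ℝ := fun x =>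
  if (x : ℝ) < b then derivWithin (T.bSpline (k + 1) i) (Set.Ici (x : ℝ)) x
  else derivWithin (T.bSpline (k + 1) i) (Set.Iic (x : ℝ)) x

/-- The space of univariate splines of degree `k` on `[a, b]`: polynomials of degree at most `k` on
each knot interval, whose derivatives of order `0, …, k - 1` match at each interior knot (that is,
the function is of class `C^{k-1}`; no condition if `k = 0`). -/
def splineSpace (T : ClampedKnots k g a b) : Submodule ℝ (Set.Icc a b → ℝ) where
  carrier := {s | ∃ p : ℕ → ℝ[X],
    (∀ j ≤ g, (p j).natDegree ≤ k) ∧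
    (∀ j ≤ g, ∀ x : Set.Icc a b, (x : ℝ) ∈ T.cell j → s x = (p j).eval (x : ℝ)) ∧
    (∀ j < g, ∀ r < k, (derivative^[r] (p j)).eval (T.knot (j + 1)) =
      (derivative^[r] (p (j + 1))).eval (T.knot (j + 1)))}
  zero_mem' := ⟨0, by simp, by simp, by simp⟩
  add_mem' := by
    rintro s t ⟨p, hp1, hp2, hp3⟩ ⟨q, hq1, hq2, hq3⟩
    refine ⟨p + q, fun j hj => natDegree_add_le_of_degree_le (hp1 j hj) (hq1 j hj), ?_, ?_⟩
    · intro j hj x hx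
      simp [hp2 j hj x hx, hq2 j hj x hx]
    · intro j hj r hr
      simp only [Pi.add_apply, iterate_map_add, eval_add, hp3 j hj r hr, hq3 j hj r hr]
  smul_mem' := by
    rintro c s ⟨p, hp1, hp2, hp3⟩
    refine ⟨c • p, fun j hj => (natDegree_smul_le c (p j)).trans (hp1 j hj), ?_, ?_⟩
    · intro j hj x hx
      simp [hp2 j hj x hx]
    · intro j hj r hr
      simp [hp3 j hj r hr, iterate_derivative_smul]

end ClampedKnots

/-- The space of tensor-product splines on `[a, b] × [c, d]`, of degree `k` in the first and `l` in
the second variable: the tensor product of the two univariate spline spaces, i.e. the linear span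
of the functions `(x, y) ↦ s x * t y` with `s`, `t` univariate splines. -/
def tensorSplineSpace {k g l h : ℕ} {a b c d : ℝ}
    (T : ClampedKnots k g a b) (U : ClampedKnots l h c d) :
    Submodule ℝ (Set.Icc a b × Set.Icc c d → ℝ) :=
  Submodule.span ℝ {f | ∃ s ∈ T.splineSpace, ∃ t ∈ U.splineSpace, f = fun p => s p.1 * t p.2}

/-- Lebesgue measure on `[a, b] × [c, d]`. -/
def rectMeasure (a b c d : ℝ) : Measure (Set.Icc a b × Set.Icc c d) :=
  ((volume : Measure ℝ).comap Subtype.val).prod ((volume : Measure ℝ).comap Subtype.val)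

/-- The subspace of tensor-product splines whose (Lebesgue) integral over `[a, b] × [c, d]` is
zero. -/
def zeroIntegralTensorSplineSpace {k g l h : ℕ} {a b c d : ℝ}
    (T : ClampedKnots k g a b) (U : ClampedKnots l h c d) :
    Submodule ℝ (Set.Icc a b × Set.Icc c d → ℝ) where
  carrier := {f | f ∈ tensorSplineSpace T U ∧ Integrable f (rectMeasure a b c d) ∧
    ∫ p, f p ∂(rectMeasure a b c d) = 0}
  zero_mem' := ⟨Submodule.zero_mem _, integrable_zero _ _ _, by simp⟩
  add_mem' := by
    rintro f f' ⟨h1, h2, h3⟩ ⟨h1', h2', h3'⟩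
    refine ⟨Submodule.add_mem _ h1 h1', h2.add h2', ?_⟩
    simp only [Pi.add_apply]
    rw [integral_add h2 h2', h3, h3', add_zero]
  smul_mem' := by
    rintro r f ⟨h1, h2, h3⟩
    refine ⟨Submodule.smul_mem _ r h1, h2.smul r, ?_⟩
    simp only [Pi.smul_apply]
    rw [integral_smul, h3, smul_zero]

/-- The functions `Z_i(x) Z_j(y)`, `Z_i(x)`, `Z_j(y)` on `[a, b] × [c, d]`, for
`i = -k, …, g - 1` and `j = -l, …, h - 1`. -/
def zbFamily {k g l h : ℕ} {a b c d : ℝ}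
    (T : ClampedKnots k g a b) (U : ClampedKnots l h c d) :
    (Set.Ico (-(k : ℤ)) (g : ℤ) × Set.Ico (-(l : ℤ)) (h : ℤ)) ⊕
      Set.Ico (-(k : ℤ)) (g : ℤ) ⊕ Set.Ico (-(l : ℤ)) (h : ℤ) →
    (Set.Icc a b × Set.Icc c d → ℝ)
  | .inl (i, j) => fun p => T.zbSpline i p.1 * U.zbSpline j p.2
  | .inr (.inl i) => fun p => T.zbSpline i p.1
  | .inr (.inr j) => fun p => U.zbSpline j p.2

end

/-! The constant 1 together with the `Z_i` is a basis of the univariate spline space. The products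
of two such bases form a basis of the tensor-product space; one product is the constant 1, and the
others are exactly `zbFamily`. Each of those has integral zero by Fubini, since each `Z_i` has
integral zero, while 1 has positive integral. Removing 1 therefore leaves a basis of the kernel of
the integral (`span_zbFamily`).

In one variable, everything is checked on polynomial pieces, cell by cell. The formula for the
derivative of a B-spline (`derivative_bSplinePiece_succ`) gives smoothness by induction on the
degree. It also shows that a combination of B-splines with zero derivative has equal coefficients
(`eq_succ_of_derivative_eq_zero`), whence the `Z_i` are independent. Their integrals vanish because
the underlying B-splines vanish at both ends. The spanning property is a dimension count: truncated
powers bound the dimension of the spline space by g + k + 1 (`splineSpace_le_span_truncatedPower`).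
-/

/-- The polynomial that agrees on the `j`-th knot interval with the B-spline of degree `m` with
knots `τ i, …, τ (i + m + 1)`. -/
noncomputable def bSplinePiece (τ : ℤ → ℝ) (j : ℤ) : ℕ → ℤ → ℝ[X]
  | 0, i => if i = j then 1 else 0
  | m + 1, i =>
      (X - C (τ i)) * (C (τ (i + m + 1) - τ i)⁻¹ * bSplinePiece τ j m i) +
      (C (τ (i + m + 2)) - X) *
        (C (τ (i + m + 2) - τ (i + 1))⁻¹ * bSplinePiece τ j m (i + 1))

/-- `bSplinePiece` divided by the length of its support. -/
noncomputable def scaledPiece (τ : ℤ → ℝ) (j : ℤ) (m : ℕ) (i : ℤ) : ℝ[X] :=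
  C (τ (i + m + 1) - τ i)⁻¹ * bSplinePiece τ j m i

/-! ### Polynomial pieces of B-splines: derivatives, smoothness, end values -/

section Piece

variable {τ : ℤ → ℝ} {j : ℤ}

lemma bSplinePiece_succ (m : ℕ) (i : ℤ) :
    bSplinePiece τ j (m + 1) i = (X - C (τ i)) * scaledPiece τ j m i +
      (C (τ (i + m + 2)) - X) * scaledPiece τ j m (i + 1) := by
  rw [bSplinePiece, scaledPiece, scaledPiece, show i + 1 + (m : ℤ) + 1 = i + m + 2 by ring]

lemma bSplinePiece_eq_zero (m : ℕ) {i : ℤ} (h : j < i ∨ i + m < j) :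
    bSplinePiece τ j m i = 0 := by
  induction m generalizing i with
  | zero => rw [bSplinePiece, if_neg]; push_cast at h; omega
  | succ m ih =>
    push_cast at h
    rw [bSplinePiece, ih (by omega), ih (by omega)]
    simp

lemma natDegree_bSplinePiece_le (m : ℕ) (i : ℤ) : (bSplinePiece τ j m i).natDegree ≤ m := by
  induction m generalizing i with
  | zero => rw [bSplinePiece]; split_ifs <;> simp
  | succ m ih =>
    rw [bSplinePiece, add_comm m 1]
    refine natDegree_add_le_of_degree_le ?_ ?_
    · exact natDegree_mul_le_of_le (natDegree_X_sub_C_le _)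
        ((natDegree_C_mul_le _ _).trans (ih i))
    · refine natDegree_mul_le_of_le ?_ ((natDegree_C_mul_le _ _).trans (ih (i + 1)))
      rw [← natDegree_neg, neg_sub]
      exact natDegree_X_sub_C_le _

lemma scaledPiece_eq_zero_of_eq (m : ℕ) {i : ℤ} (h : τ (i + m + 1) = τ i) :
    scaledPiece τ j m i = 0 := by
  simp [scaledPiece, h]

/-- Induction through the product rule. Write S for scaled pieces of degree m + 1 and s for those of
degree m. The recursion for S turns the two terms containing S' into (m + 1)(S_i - s_{i+1}) and (m +
1)(s_{i+1} - S_{i+1}), and s_{i+1} cancels. -/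
lemma derivative_bSplinePiece_succ (hτ : Monotone τ) (m : ℕ) (i : ℤ) :
    derivative (bSplinePiece τ j (m + 1) i) =
      C ((m : ℝ) + 1) * (scaledPiece τ j m i - scaledPiece τ j m (i + 1)) := by
  induction m generalizing i with
  | zero =>
    have hd : ∀ i, derivative (scaledPiece τ j 0 i) = 0 := fun i => by
      rw [scaledPiece, bSplinePiece]; split_ifs <;> simp
    rw [bSplinePiece_succ]
    simp [hd]
    ring
  | succ m ih =>
    have hs : ∀ i, derivative (scaledPiece τ j (m + 1) i) = C (τ (i + m + 2) - τ i)⁻¹ *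
        (C ((m : ℝ) + 1) * (scaledPiece τ j m i - scaledPiece τ j m (i + 1))) := fun i => by
      rw [scaledPiece, derivative_C_mul, ih]
      push_cast
      rw [show i + ((m : ℤ) + 1) + 1 = i + m + 2 by ring]
    have he : ∀ i, scaledPiece τ j (m + 1) i = C (τ (i + m + 2) - τ i)⁻¹ *
        ((X - C (τ i)) * scaledPiece τ j m i +
          (C (τ (i + m + 2)) - X) * scaledPiece τ j m (i + 1)) := fun i => by
      rw [scaledPiece, bSplinePiece_succ]
      push_cast
      rw [show i + ((m : ℤ) + 1) + 1 = i + m + 2 by ring]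
    -- If the length vanishes, the inverse is 0, but then the knots of the scaled piece coincide by
    -- monotonicity and it is 0 as well.
    have hcancel : ∀ i i' : ℤ, (i' = i ∨ i' = i + 1) → C (τ (i + m + 2) - τ i)⁻¹ *
        (C (τ (i + m + 2)) - C (τ i)) * scaledPiece τ j m i' = scaledPiece τ j m i' := by
      intro i i' hi
      by_cases h : τ (i + m + 2) = τ i
      · rw [scaledPiece_eq_zero_of_eq, mul_zero]
        apply le_antisymm
        · calc τ (i' + m + 1) ≤ τ (i + m + 2) := hτ (by omega)
            _ = τ i := h
            _ ≤ τ i' := hτ (by omega)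
        · exact hτ (by omega)
      · rw [← C_sub, ← C_mul, inv_mul_cancel₀ (sub_ne_zero.mpr h), C_1, one_mul]
    rw [bSplinePiece_succ]
    simp only [derivative_add, derivative_mul, derivative_sub, derivative_X, derivative_C, hs]
    have h1 := hcancel i (i + 1) (Or.inr rfl)
    have h2 := hcancel (i + 1) (i + 1) (Or.inl rfl)
    have e1 := he i
    have e2 := he (i + 1)
    push_cast
    rw [show i + 1 + (m : ℤ) + 2 = i + (m + 1) + 2 by ring] at *
    simp only [C_add, C_1] at *
    linear_combination (C (m : ℝ) + 1) * (h2 - h1 - e1 + e2)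

/-- Adjacent pieces of a B-spline of degree `m` join with `m - 1` continuous derivatives at a
simple knot. -/
lemma eval_iterate_derivative_bSplinePiece (hτ : Monotone τ) (h₁ : τ j < τ (j + 1))
    (h₂ : τ (j + 1) < τ (j + 2)) (m : ℕ) (i : ℤ) {r : ℕ} (hr : r < m) :
    (derivative^[r] (bSplinePiece τ j m i)).eval (τ (j + 1)) =
      (derivative^[r] (bSplinePiece τ (j + 1) m i)).eval (τ (j + 1)) := by
  induction m generalizing i r with
  | zero => omega
  | succ m ih =>
    cases r with
    | zero =>
      simp only [Function.iterate_zero, id_eq]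
      -- Degree 1 is checked directly, because pieces of degree 0 jump at the knot. In higher degree
      -- the recursion passes continuity on.
      cases m with
      | zero =>
        have h₁' := sub_ne_zero.mpr h₁.ne'
        have h₂' := sub_ne_zero.mpr h₂.ne'
        simp only [bSplinePiece]
        rcases eq_or_ne i j with rfl | hi
        · simp [h₁', h₂']
        rcases eq_or_ne i (j + 1) with rfl | hi'
        · simp [add_assoc]
        rcases eq_or_ne (i + 1) j with rfl | hi''
        · simp [add_assoc, hi]
        · simp [hi, hi', hi'']
      | succ m =>
        have h := fun i => ih i (r := 0) (by omega)
        simp only [Function.iterate_zero, id_eq] at h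
        simp only [bSplinePiece_succ (m + 1), scaledPiece, eval_add, eval_mul, h]
    | succ r =>
      have h := fun i => ih i (r := r) (by omega)
      simp only [Function.iterate_succ, Function.comp_apply, derivative_bSplinePiece_succ hτ,
        scaledPiece, iterate_derivative_C_mul, iterate_derivative_sub, eval_mul, eval_sub, h]

/-- In the recursion the second term vanishes by induction. The first has the factor `X - C (τ i)`,
zero at the left end if i ≤ 0; for i > 0 its piece is zero on this cell. -/
lemma eval_bSplinePiece_left (hτ : ∀ i ≤ 0, τ i = τ 0) (m : ℕ) {i : ℤ} (hi : -(m : ℤ) < i) :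
    (bSplinePiece τ 0 m i).eval (τ 0) = 0 := by
  induction m generalizing i with
  | zero => rw [bSplinePiece_eq_zero]; simp; push_cast at hi; omega
  | succ m ih =>
    push_cast at hi
    rw [bSplinePiece]
    simp only [eval_add, eval_mul, ih (i := i + 1) (by omega)]
    rcases le_or_gt i 0 with h | h
    · simp [hτ i h]
    · simp [bSplinePiece_eq_zero m (τ := τ) (Or.inl h)]

lemma eval_bSplinePiece_left_eq_one (hτ : ∀ i ≤ 0, τ i = τ 0) (h₁ : τ 0 < τ 1) (m : ℕ) :
    (bSplinePiece τ 0 m (-m)).eval (τ 0) = 1 := by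
  induction m with
  | zero => simp [bSplinePiece]
  | succ m ih =>
    rw [bSplinePiece]
    push_cast
    rw [show -((m : ℤ) + 1) + m + 2 = 1 by ring, show -((m : ℤ) + 1) + 1 = -m by ring]
    simp only [eval_add, eval_mul, eval_sub, eval_C, eval_X, ih, hτ (-m) (by omega),
      hτ (-(m + 1)) (by omega)]
    rw [sub_self, zero_mul, zero_add, mul_one, mul_inv_cancel₀ (sub_ne_zero.mpr h₁.ne')]

lemma eval_bSplinePiece_right {n : ℤ} (hτ : ∀ i ≥ n + 1, τ i = τ (n + 1)) (m : ℕ) {i : ℤ}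
    (hi : i < n) : (bSplinePiece τ n m i).eval (τ (n + 1)) = 0 := by
  induction m generalizing i with
  | zero => rw [bSplinePiece_eq_zero]; simp; push_cast; omega
  | succ m ih =>
    rw [bSplinePiece]
    simp only [eval_add, eval_mul, ih hi]
    rcases le_or_gt (n + 1) (i + m + 2) with h | h
    · simp [hτ _ h]
    · simp [bSplinePiece_eq_zero m (τ := τ) (i := i + 1) (j := n) (Or.inr (by omega))]

end Piece

/-- Summation by parts, which moves the differences onto the coefficients. -/
lemma sum_range_mul_sub_succ {R : Type*} [CommRing R] (c f : ℕ → R) (n : ℕ) :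
    ∑ i ∈ Finset.range (n + 1), c i * (f i - f (i + 1)) =
      c 0 * f 0 - c n * f (n + 1) +
        ∑ i ∈ Finset.range n, (c (i + 1) - c i) * f (i + 1) := by
  induction n with
  | zero => simp; ring
  | succ n ih => rw [Finset.sum_range_succ, ih, Finset.sum_range_succ _ n]; ring

/-! ### Cells of a clamped knot sequence and splines on them -/

namespace ClampedKnots

variable {k g : ℕ} {a b : ℝ} (T : ClampedKnots k g a b)

/-- The knot sequence, continued by the constants `a` and `b`. -/
noncomputable def clamped (i : ℤ) : ℝ := T.knot (max 0 (min i (g + 1)))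

lemma clamped_eq_knot {i : ℤ} (h₀ : -(k : ℤ) ≤ i) (h₁ : i ≤ g + k + 1) :
    T.clamped i = T.knot i := by
  rw [clamped]
  rcases le_or_gt i 0 with h | h
  · rw [T.left i h₀ h, T.left _ (by omega) (by omega)]
  rcases le_or_gt ((g : ℤ) + 1) i with h' | h'
  · rw [T.right i h' h₁, T.right _ (by omega) (by omega)]
  · congr 1; omega

lemma clamped_of_le {i : ℤ} (h : i ≤ 0) : T.clamped i = a :=
  T.left _ (by omega) (by omega)

lemma clamped_of_ge {i : ℤ} (h : (g : ℤ) + 1 ≤ i) : T.clamped i = b :=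
  T.right _ (by omega) (by omega)

lemma clamped_monotone : Monotone T.clamped := fun i i' h =>
  T.strictMono.monotoneOn (by simp; omega) (by simp; omega) (by omega)

lemma clamped_lt {i i' : ℤ} (h : i < i') (h₀ : 0 < i') (h₁ : i ≤ g) :
    T.clamped i < T.clamped i' :=
  T.strictMono (by simp; omega) (by simp; omega) (by omega)

lemma left_lt_right (T : ClampedKnots k g a b) : a < b := by
  have := clamped_lt T (i := 0) (i' := g + 1) (by omega) (by omega) (by omega)
  rwa [T.clamped_of_le le_rfl, T.clamped_of_ge le_rfl] at this

/-- The polynomial pieces of the B-splines. -/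
noncomputable abbrev piece (j : ℤ) (m : ℕ) (i : ℤ) : ℝ[X] := bSplinePiece T.clamped j m i

lemma mem_cell_iff {j : ℤ} (h₀ : 0 ≤ j) (h₁ : j ≤ g) {x : ℝ} :
    x ∈ T.cell j ↔ T.clamped j ≤ x ∧ (x < T.clamped (j + 1) ∨ x = b ∧ j = g) := by
  rw [cell, ← T.clamped_eq_knot (i := j) (by omega) (by omega),
    ← T.clamped_eq_knot (i := j + 1) (by omega) (by omega)]
  have hlt := T.clamped_lt (i := j) (i' := j + 1) (by omega) (by omega) (by omega)
  simp only [Set.mem_union, Set.mem_Ico, Set.mem_inter_iff, Set.mem_Ioc, Set.mem_singleton_iff]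
  constructor
  · rintro (h | ⟨h, rfl⟩)
    · exact ⟨h.1, Or.inl h.2⟩
    · refine ⟨h.1.le, Or.inr ⟨rfl, ?_⟩⟩
      by_contra hj
      have := T.clamped_lt (i := j + 1) (i' := g + 1) (by omega) (by omega) (by omega)
      rw [T.clamped_of_ge le_rfl] at this
      linarith
  · rintro ⟨h, h' | ⟨rfl, rfl⟩⟩
    · exact Or.inl ⟨h, h'⟩
    · rw [T.clamped_of_ge le_rfl] at *
      exact Or.inr ⟨⟨hlt, le_rfl⟩, rfl⟩

lemma cell_eq_empty {j : ℤ} (h₀ : -(k : ℤ) ≤ j) (h₁ : j ≤ g + k) (h : j < 0 ∨ g < j) :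
    T.cell j = ∅ := by
  have : T.knot j = T.knot (j + 1) := by
    rw [← T.clamped_eq_knot (i := j) (by omega) (by omega),
      ← T.clamped_eq_knot (i := j + 1) (by omega) (by omega)]
    rcases h with h | h
    · rw [T.clamped_of_le (by omega), T.clamped_of_le (by omega)]
    · rw [T.clamped_of_ge (by omega), T.clamped_of_ge (by omega)]
  simp [cell, this]

lemma notMem_cell {i j : ℤ} (h₀ : 0 ≤ i) (h₁ : i ≤ g) (h₀' : 0 ≤ j) (h₁' : j ≤ g) (h : i < j)
    {x : ℝ} (hx : x ∈ T.cell i) : x ∉ T.cell j := by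
  rw [T.mem_cell_iff h₀ h₁] at hx
  rw [T.mem_cell_iff h₀' h₁']
  have := T.clamped_monotone (show i + 1 ≤ j by omega)
  rintro ⟨h2, -⟩
  rcases hx.2 with h3 | h3
  · linarith
  · omega

lemma cell_unique {i j : ℤ} (h₀ : 0 ≤ i) (h₁ : i ≤ g) (h₀' : 0 ≤ j) (h₁' : j ≤ g)
    {x : ℝ} (hx : x ∈ T.cell i) (hx' : x ∈ T.cell j) : i = j := by
  rcases lt_trichotomy i j with h | h | h
  · exact absurd hx' (T.notMem_cell h₀ h₁ h₀' h₁' h hx)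
  · exact h
  · exact absurd hx (T.notMem_cell h₀' h₁' h₀ h₁ h hx')

lemma cell_subset {j : ℤ} (h₀ : 0 ≤ j) (h₁ : j ≤ g) : T.cell j ⊆ Set.Icc a b := by
  intro x hx
  rw [T.mem_cell_iff h₀ h₁] at hx
  have h2 := T.clamped_monotone h₀
  have h3 := T.clamped_monotone (show j + 1 ≤ g + 1 by omega)
  rw [T.clamped_of_le le_rfl] at h2
  rw [T.clamped_of_ge le_rfl] at h3
  refine ⟨h2.trans hx.1, ?_⟩
  rcases hx.2 with h | h
  · linarith
  · exact h.1.le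

lemma exists_mem_cell {x : ℝ} (hx : x ∈ Set.Icc a b) :
    ∃ j : ℕ, j ≤ g ∧ x ∈ T.cell j := by
  suffices h : ∀ n : ℕ, n ≤ g → x < T.clamped (n + 1) → ∃ j : ℕ, j ≤ g ∧ x ∈ T.cell j by
    rcases hx.2.lt_or_eq with h' | h'
    · exact h g le_rfl (by rwa [T.clamped_of_ge le_rfl])
    · refine ⟨g, le_rfl, (T.mem_cell_iff (by omega) (by omega)).mpr ⟨?_, Or.inr ⟨h', rfl⟩⟩⟩
      exact (T.clamped_monotone (by omega)).trans_eq ((T.clamped_of_ge le_rfl).trans h'.symm)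
  intro n
  induction n with
  | zero =>
    intro h0 h1
    refine ⟨0, h0, (T.mem_cell_iff (by omega) (by omega)).mpr ⟨?_, Or.inl h1⟩⟩
    rw [T.clamped_of_le (by simp)]
    exact hx.1
  | succ n ih =>
    intro h0 h1
    rcases lt_or_ge x (T.clamped (n + 1)) with h | h
    · exact ih (by omega) h
    · exact ⟨n + 1, h0, (T.mem_cell_iff (by omega) (by omega)).mpr ⟨by simpa using h, Or.inl h1⟩⟩

/-- On each cell, a B-spline is given by its polynomial piece. -/
lemma bSpline_eq_eval {j : ℤ} (h₀ : 0 ≤ j) (h₁ : j ≤ g) {x : ℝ} (hx : x ∈ T.cell j) (m : ℕ)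
    {i : ℤ} (hi : -(k : ℤ) ≤ i) (hi' : i + m ≤ g + k) :
    T.bSpline m i x = (T.piece j m i).eval x := by
  induction m generalizing i with
  | zero =>
    rw [bSpline, piece, bSplinePiece]
    split_ifs with h
    · subst h; simp [hx]
    · rw [Set.indicator_of_notMem, eval_zero]
      intro hx'
      -- Cells between repeated end knots are empty, so only indices 0 to g matter.
      by_cases hi2 : i < 0 ∨ g < i
      · rw [T.cell_eq_empty hi (by simpa using hi') hi2] at hx'; exact hx'
      · exact h (T.cell_unique (by omega) (by omega) h₀ h₁ hx' hx)
  | succ m ih =>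
    push_cast at hi'
    simp only [bSpline]
    rw [ih hi (by omega), ih (by omega) (by omega)]
    simp only [piece]
    rw [bSplinePiece_succ, scaledPiece, scaledPiece,
      show i + 1 + (m : ℤ) + 1 = i + m + 2 by ring]
    rw [T.clamped_eq_knot (i := i) (by omega) (by omega),
      T.clamped_eq_knot (i := i + 1) (by omega) (by omega),
      T.clamped_eq_knot (i := i + m + 1) (by omega) (by omega),
      T.clamped_eq_knot (i := i + m + 2) (by omega) (by omega)]
    simp only [eval_add, eval_mul, eval_sub, eval_X, eval_C]
    ring

/-- A ZB-spline is given on each cell by the derivative of the piece of the B-spline. -/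
lemma zbSpline_eq_eval {j : ℤ} (h₀ : 0 ≤ j) (h₁ : j ≤ g) {x : Set.Icc a b}
    (hx : (x : ℝ) ∈ T.cell j) {i : ℤ} (hi : -(k : ℤ) ≤ i) (hi' : i < g) :
    T.zbSpline i x = (derivative (T.piece j (k + 1) i)).eval (x : ℝ) := by
  have hb : ∀ y ∈ T.cell j, T.bSpline (k + 1) i y = (T.piece j (k + 1) i).eval y :=
    fun y hy => T.bSpline_eq_eval h₀ h₁ hy _ hi (by push_cast; omega)
  have hc := (T.mem_cell_iff h₀ h₁).mp hx
  rw [zbSpline]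
  split_ifs with h
  -- The cell contains a right neighbourhood of x, so the one-sided derivative sees a single
  -- polynomial.
  · have hlt : (x : ℝ) < T.clamped (j + 1) := hc.2.resolve_right fun h' => h.ne h'.1
    rw [Filter.EventuallyEq.derivWithin_eq (f₁ := T.bSpline (k + 1) i)
      (f := fun y => (T.piece j (k + 1) i).eval y) _ (hb _ hx)]
    · exact Polynomial.derivWithin _ (uniqueDiffOn_Ici _ _ Set.self_mem_Ici)
    · filter_upwards [Ico_mem_nhdsGE hlt] with y hy
      exact hb y ((T.mem_cell_iff h₀ h₁).mpr ⟨hc.1.trans hy.1, Or.inl hy.2⟩)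
  -- At b the cell is the last one and contains a left neighbourhood.
  · have hxb : (x : ℝ) = b := le_antisymm x.2.2 (not_lt.mp h)
    have hjg : j = g := by
      rcases hc.2 with h' | h'
      · have := (T.clamped_monotone (show j + 1 ≤ g + 1 by omega))
        rw [T.clamped_of_ge le_rfl] at this
        linarith
      · exact h'.2
    have hlt : T.clamped j < x := by
      exact (T.clamped_lt (by omega) (by omega) (by omega)).trans_eq
        ((T.clamped_of_ge le_rfl).trans hxb.symm)
    rw [Filter.EventuallyEq.derivWithin_eq (f₁ := T.bSpline (k + 1) i)
      (f := fun y => (T.piece j (k + 1) i).eval y) _ (hb _ hx)]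
    · exact Polynomial.derivWithin _ (uniqueDiffOn_Iic _ _ Set.self_mem_Iic)
    · filter_upwards [Ioc_mem_nhdsLE hlt] with y hy
      refine hb y ((T.mem_cell_iff h₀ h₁).mpr ⟨hy.1.le, ?_⟩)
      rcases hy.2.lt_or_eq with h' | h'
      · rw [hxb] at h'
        rw [hjg, T.clamped_of_ge le_rfl]
        exact Or.inl h'
      · exact Or.inr ⟨h'.trans hxb, hjg⟩

lemma zbSpline_mem {i : ℤ} (hi : -(k : ℤ) ≤ i) (hi' : i < g) : T.zbSpline i ∈ T.splineSpace := by
  refine ⟨fun j => derivative (T.piece j (k + 1) i), fun j _ => ?_, fun j hj x hx => ?_,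
    fun j hj r hr => ?_⟩
  · exact (natDegree_derivative_le _).trans (Nat.sub_le_sub_right (natDegree_bSplinePiece_le _ _) 1)
  · exact T.zbSpline_eq_eval (by omega) (by omega) hx hi hi'
  · have := eval_iterate_derivative_bSplinePiece T.clamped_monotone (j := j)
      (T.clamped_lt (by omega) (by omega) (by omega))
      (T.clamped_lt (by omega) (by omega) (by omega)) (k + 1) i (r := r + 1) (by omega)
    rw [← T.clamped_eq_knot (by omega) (by omega)]
    simpa using this

lemma one_mem_splineSpace : (1 : Set.Icc a b → ℝ) ∈ T.splineSpace := by
  refine ⟨fun _ => 1, by simp, by simp, by simp⟩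

/-! ### Linear independence of B-splines -/

/-- By the derivative formula and summation by parts, the derivative is a combination of B-splines
of degree m whose coefficients are multiples of `c (n + 1) - c n`. The hypothesis `ih` is
independence in degree m. The result serves both the induction for B-splines and the independence of
the ZB-splines. -/
lemma eq_succ_of_derivative_eq_zero {m : ℕ}
    (ih : ∀ c : ℕ → ℝ, (∀ j : ℕ, j ≤ g → ∑ n ∈ Finset.range (g + m + 1),
      C (c n) * T.piece j m (n - m) = 0) → ∀ n < g + m + 1, c n = 0)
    {c : ℕ → ℝ} (hc : ∀ j : ℕ, j ≤ g → derivative (∑ n ∈ Finset.range (g + m + 2),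
      C (c n) * T.piece j (m + 1) (n - (m + 1))) = 0) {n : ℕ} (hn : n < g + m + 1) :
    c (n + 1) = c n := by
  have hne : ∀ n : ℕ, n < g + m + 1 → T.clamped (n + 1) - T.clamped (n - m) ≠ 0 := fun n hn =>
    sub_ne_zero.mpr (T.clamped_lt (by omega) (by omega) (by omega)).ne'
  have key := ih (fun n => (c (n + 1) - c n) * (T.clamped (n + 1) - T.clamped (n - m))⁻¹) ?_ n hn
  · rw [mul_eq_zero, or_iff_left (inv_ne_zero (hne n hn))] at key
    linarith
  intro j hj
  have h := hc j hj
  simp only [derivative_sum, derivative_C_mul, piece,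
    derivative_bSplinePiece_succ T.clamped_monotone] at h
  have h2 : C ((m : ℝ) + 1) * ∑ n ∈ Finset.range (g + m + 1 + 1), C (c n) *
      ((fun n : ℕ => scaledPiece T.clamped j m (n - (m + 1))) n -
        (fun n : ℕ => scaledPiece T.clamped j m (n - (m + 1))) (n + 1)) = 0 := by
    rw [← h, Finset.mul_sum]
    refine Finset.sum_congr rfl fun n _ => ?_
    push_cast
    rw [show (n : ℤ) - (m + 1) + 1 = n + 1 - (m + 1) by ring]
    ring
  rw [mul_eq_zero, or_iff_right (C_ne_zero.mpr (by positivity)),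
    sum_range_mul_sub_succ (fun n => C (c n))] at h2
  -- Both boundary terms vanish: the first has all its knots at a, the last starts at or beyond b.
  rw [scaledPiece_eq_zero_of_eq m (i := ((0 : ℕ) : ℤ) - (m + 1)), scaledPiece,
    bSplinePiece_eq_zero m (i := ((g + m + 1 + 1 : ℕ) : ℤ) - (m + 1))] at h2
  rotate_left
  · push_cast; omega
  · rw [T.clamped_of_le, T.clamped_of_le] <;> push_cast <;> omega
  simp only [mul_zero, sub_zero, zero_add] at h2
  rw [← h2]
  refine Finset.sum_congr rfl fun n _ => ?_
  rw [scaledPiece]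
  push_cast
  rw [show (n : ℤ) + 1 - (m + 1) = n - m by ring, show (n : ℤ) - m + m + 1 = n + 1 by ring, C_mul,
    C_sub]
  ring

/-- In degree 0 the pieces are indicators of the cells. In the induction step all coefficients are
equal, and the first is 0 because only the first B-spline is nonzero at a. -/
lemma piece_linearIndependent (m : ℕ) (c : ℕ → ℝ)
    (hc : ∀ j : ℕ, j ≤ g → ∑ n ∈ Finset.range (g + m + 1), C (c n) * T.piece j m (n - m) = 0)
    {n : ℕ} (hn : n < g + m + 1) : c n = 0 := by
  induction m generalizing c n with
  | zero =>
    have h := hc n (by omega)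
    rw [Finset.sum_eq_single_of_mem n (by simpa using hn)] at h
    · simpa [piece, bSplinePiece] using h
    · intro i _ hi
      simp [piece, bSplinePiece, hi]
  | succ m ih =>
    have hstep : ∀ n < g + m + 1, c (n + 1) = c n := fun n hn =>
      T.eq_succ_of_derivative_eq_zero (fun c hc n hn => ih c hc hn) (fun j hj => by
        have := hc j hj
        push_cast at this
        rw [show g + m + 2 = g + (m + 1) + 1 by ring, this, derivative_zero]) hn
    have hleft : ∀ i ≤ 0, T.clamped i = T.clamped 0 := fun i hi => by
      rw [T.clamped_of_le hi, T.clamped_of_le le_rfl]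
    have h0 : c 0 = 0 := by
      have h := congrArg (eval (T.clamped 0)) (hc 0 (by omega))
      rw [eval_finsetSum, Finset.sum_eq_single_of_mem 0 (by simp)] at h
      · rw [eval_mul, eval_C, piece] at h
        rw [show ((0 : ℕ) : ℤ) - ((m + 1 : ℕ) : ℤ) = -((m + 1 : ℕ) : ℤ) by simp] at h
        rw [Nat.cast_zero, eval_bSplinePiece_left_eq_one hleft
          (T.clamped_lt (by omega) (by omega) (by omega))] at h
        simpa using h
      · intro i _ hi
        rw [eval_mul, piece, Nat.cast_zero, eval_bSplinePiece_left hleft _ (by omega), mul_zero]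
    induction n with
    | zero => exact h0
    | succ n ihn => rw [hstep n (by omega), ihn (by omega)]

end ClampedKnots

/-! ### Integrals and independence of ZB-splines -/

lemma isFiniteMeasure_comap_Icc (a b : ℝ) :
    IsFiniteMeasure ((volume : Measure ℝ).comap (Subtype.val : Set.Icc a b → ℝ)) := by
  constructor
  rw [comap_subtype_coe_apply measurableSet_Icc, Set.image_univ, Subtype.range_coe]
  exact measure_Icc_lt_top

/-- The integrable functions with integral zero. -/
noncomputable def zeroIntegralSubmodule {α : Type*} [MeasurableSpace α] (μ : Measure α) :
    Submodule ℝ (α → ℝ) where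
  carrier := {f | Integrable f μ ∧ ∫ x, f x ∂μ = 0}
  zero_mem' := ⟨integrable_zero _ _ _, by simp⟩
  add_mem' := by
    rintro f g ⟨hf, hf'⟩ ⟨hg, hg'⟩
    exact ⟨hf.add hg, by simp [integral_add hf hg, hf', hg']⟩
  smul_mem' := by
    rintro r f ⟨hf, hf'⟩
    exact ⟨hf.smul r, by simp [integral_const_mul, hf']⟩

namespace ClampedKnots

variable {k g : ℕ} {a b : ℝ} (T : ClampedKnots k g a b)

lemma integrable_and_integral_eq {s : Set.Icc a b → ℝ} {p : ℕ → ℝ[X]}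
    (hp : ∀ j ≤ g, ∀ x : Set.Icc a b, (x : ℝ) ∈ T.cell j → s x = (p j).eval (x : ℝ)) :
    Integrable s ((volume : Measure ℝ).comap Subtype.val) ∧
    ∫ x, s x ∂((volume : Measure ℝ).comap Subtype.val) =
      ∑ j ∈ Finset.range (g + 1), ∫ x in T.clamped j..T.clamped (j + 1), (p j).eval x := by
  classical
  set F : ℝ → ℝ := fun x => if h : x ∈ Set.Icc a b then s ⟨x, h⟩ else 0 with hF
  have hsF : s = F ∘ Subtype.val := by
    ext x
    simp only [hF, Function.comp_apply, dif_pos x.2, Subtype.coe_eta]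
  have hle : ∀ j : ℕ, T.clamped j ≤ T.clamped (j + 1) := fun j => T.clamped_monotone (by omega)
  have hFp : ∀ j : ℕ, j ≤ g → Set.EqOn (fun x => (p j).eval x) F
      (Set.Ioo (T.clamped j) (T.clamped (j + 1))) := by
    intro j hj x hx
    have hx' : x ∈ T.cell j :=
      (T.mem_cell_iff (by omega) (by omega)).mpr ⟨hx.1.le, Or.inl hx.2⟩
    have hx'' := T.cell_subset (by omega) (by omega) hx'
    simp only [hF, dif_pos hx'']
    exact (hp j hj ⟨x, hx''⟩ hx').symm
  have hint : ∀ j : ℕ, j ≤ g → IntervalIntegrable F volume (T.clamped j) (T.clamped (j + 1)) := by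
    intro j hj
    have h := (p j).continuous.intervalIntegrable (μ := volume) (T.clamped j) (T.clamped (j + 1))
    rw [intervalIntegrable_iff_integrableOn_Ioo_of_le (hle j)] at h ⊢
    exact h.congr_fun (hFp j hj) measurableSet_Ioo
  have h0 : T.clamped ((0 : ℕ) : ℤ) = a := T.clamped_of_le (by simp)
  have h1 : T.clamped ((g + 1 : ℕ) : ℤ) = b := T.clamped_of_ge (by simp)
  constructor
  · have htrans : IntervalIntegrable F volume (T.clamped (0 : ℕ)) (T.clamped (g + 1 : ℕ)) :=
      IntervalIntegrable.trans_iterate (a := fun j : ℕ => T.clamped j) fun j hj => by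
        simpa using hint j (by omega)
    rw [h0, h1, intervalIntegrable_iff_integrableOn_Ioc_of_le T.left_lt_right.le,
      ← integrableOn_Icc_iff_integrableOn_Ioc,
      integrableOn_iff_comap_subtypeVal measurableSet_Icc, ← hsF] at htrans
    exact htrans
  · have h : ∫ x, s x ∂((volume : Measure ℝ).comap Subtype.val) = ∫ x in Set.Icc a b, F x := by
      rw [hsF]
      exact integral_subtype_comap measurableSet_Icc F
    have hsum := intervalIntegral.sum_integral_adjacent_intervals (f := F) (μ := volume)
      (n := g + 1) (a := fun j : ℕ => T.clamped j) fun j hj => by simpa using hint j (by omega)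
    rw [h0, h1] at hsum
    rw [h, integral_Icc_eq_integral_Ioc, ← intervalIntegral.integral_of_le T.left_lt_right.le,
      ← hsum]
    refine Finset.sum_congr rfl fun j hj => ?_
    rw [Finset.mem_range] at hj
    push_cast
    rw [intervalIntegral.integral_of_le (hle j), intervalIntegral.integral_of_le (hle j),
      integral_Ioc_eq_integral_Ioo, integral_Ioc_eq_integral_Ioo]
    exact (setIntegral_congr_fun measurableSet_Ioo (hFp j (by omega))).symm

lemma zbSpline_mem_zeroIntegral {i : ℤ} (hi : -(k : ℤ) ≤ i) (hi' : i < g) :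
    T.zbSpline i ∈ zeroIntegralSubmodule ((volume : Measure ℝ).comap Subtype.val) := by
  obtain ⟨h1, h2⟩ := T.integrable_and_integral_eq (s := T.zbSpline i)
    (p := fun j => derivative (T.piece j (k + 1) i)) fun j hj x hx =>
      T.zbSpline_eq_eval (by omega) (by omega) hx hi hi'
  refine ⟨h1, h2.trans ?_⟩
  have hleft : ∀ i ≤ 0, T.clamped i = T.clamped 0 := fun i hi => by
    rw [T.clamped_of_le hi, T.clamped_of_le le_rfl]
  have hright : ∀ i ≥ (g : ℤ) + 1, T.clamped i = T.clamped (g + 1) := fun i hi => by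
    rw [T.clamped_of_ge hi, T.clamped_of_ge le_rfl]
  -- Value of the B-spline at the j-th knot. The default 0 at j = g + 1 is its true value at b, so
  -- the sum over cells telescopes.
  let v : ℕ → ℝ := fun j => if j ≤ g then (T.piece j (k + 1) i).eval (T.clamped j) else 0
  have hv : ∀ j ∈ Finset.range (g + 1), (∫ x in T.clamped j..T.clamped (j + 1),
      (derivative (T.piece j (k + 1) i)).eval x) = v (j + 1) - v j := by
    intro j hj
    rw [Finset.mem_range] at hj
    rw [intervalIntegral.integral_eq_sub_of_hasDerivAt (fun x _ => Polynomial.hasDerivAt _ x)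
      ((derivative _).continuous.intervalIntegrable _ _)]
    simp only [v, if_pos (show j ≤ g by omega)]
    congr 1
    split_ifs with h
    · have := eval_iterate_derivative_bSplinePiece T.clamped_monotone (j := j)
        (T.clamped_lt (by omega) (by omega) (by omega))
        (T.clamped_lt (by omega) (by omega) (by omega)) (k + 1) i (r := 0) (by omega)
      simpa using this
    · obtain rfl : j = g := by omega
      exact eval_bSplinePiece_right hright _ hi'
  rw [Finset.sum_congr rfl hv, Finset.sum_range_sub]
  simp only [v, if_neg (show ¬ g + 1 ≤ g by omega), if_pos (Nat.zero_le g), zero_sub, neg_eq_zero]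
  simpa using eval_bSplinePiece_left hleft (k + 1) (i := i) (by push_cast; omega)

lemma eq_of_forall_mem_cell {j : ℕ} (hj : j ≤ g) {p q : ℝ[X]}
    (h : ∀ x ∈ T.cell j, p.eval x = q.eval x) : p = q := by
  apply Polynomial.eq_of_infinite_eval_eq
  refine (Set.Ioo_infinite (T.clamped_lt (i := j) (i' := j + 1) (by omega) (by omega)
    (by omega))).mono fun x hx => h x ?_
  exact (T.mem_cell_iff (by omega) (by omega)).mpr ⟨hx.1.le, Or.inl hx.2⟩

lemma linearIndependent_zbSpline :
    LinearIndependent ℝ (fun i : Set.Ico (-(k : ℤ)) (g : ℤ) => T.zbSpline i) := by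
  suffices h : LinearIndependent ℝ (fun n : Fin (g + k) => T.zbSpline ((n : ℤ) - k)) by
    have h2 := h.comp (fun i : Set.Ico (-(k : ℤ)) (g : ℤ) =>
      (⟨((i : ℤ) + k).toNat, by have := i.2.1; have := i.2.2; omega⟩ : Fin (g + k))) (by
        intro i i' hii
        have := i.2.1
        have := i'.2.1
        simp only [Fin.mk.injEq] at hii
        ext
        omega)
    convert h2 using 2 with i
    have := i.2.1
    simp only [Function.comp_apply]
    congr 1
    omega
  rw [Fintype.linearIndependent_iff]
  intro e he
  -- The coefficients are padded by 0 for the two extreme B-splines, with indices -k-1 and g. All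
  -- B-spline coefficients are then equal, hence equal to the padding.
  let c : ℕ → ℝ := fun n => if h : 0 < n ∧ n < g + k + 1 then e ⟨n - 1, by omega⟩ else 0
  have hc : ∀ n < g + k + 1, c (n + 1) = c n := fun n hn => by
    refine T.eq_succ_of_derivative_eq_zero
      (fun c hc n hn => T.piece_linearIndependent k c hc hn) (fun j hj => ?_) hn
    refine T.eq_of_forall_mem_cell hj fun x hx => ?_
    have h := congrFun he ⟨x, T.cell_subset (by omega) (by omega) hx⟩
    simp only [Finset.sum_apply, Pi.smul_apply, smul_eq_mul, Pi.zero_apply] at h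
    rw [eval_zero, ← h, Finset.sum_range_succ, Finset.sum_range_succ']
    simp only [derivative_add, derivative_sum, derivative_C_mul, eval_add, eval_finsetSum,
      eval_mul, eval_C]
    rw [show c 0 = 0 by simp [c], show c (g + k + 1) = 0 by simp [c], zero_mul, zero_mul,
      add_zero, add_zero, Finset.sum_range]
    refine Finset.sum_congr rfl fun n _ => ?_
    have hn := n.2
    rw [T.zbSpline_eq_eval (j := j) (by omega) (by omega) hx (by omega) (by omega)]
    simp only [c]
    rw [dif_pos (by omega)]
    push_cast
    rw [show (n : ℤ) + 1 - (k + 1) = n - k by ring]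
  have h0 : ∀ n < g + k + 2, c n = 0 := fun n hn => by
    induction n with
    | zero => simp [c]
    | succ n ih => rw [hc n (by omega), ih (by omega)]
  intro n
  have h := h0 (n + 1) (by omega)
  simp only [c] at h
  rw [dif_pos (by omega)] at h
  exact h

/-! ### Truncated powers and the univariate basis -/

lemma exists_eq_C_mul_X_sub_C_pow {q : ℝ[X]} {k : ℕ} {t : ℝ} (hq : q.natDegree ≤ k)
    (h : ∀ r < k, (derivative^[r] q).eval t = 0) : ∃ c : ℝ, q = C c * (X - C t) ^ k := by
  have hcoeff : ∀ r < k, (taylor t q).coeff r = 0 := fun r hr => by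
    have h2 := congrArg (fun f => eval t (f q)) (factorial_smul_hasseDeriv (R := ℝ) r)
    simp only [LinearMap.smul_apply, eval_smul, h r hr] at h2
    rw [taylor_coeff]
    simpa [r.factorial_ne_zero] using h2
  refine ⟨(taylor t q).coeff k, ?_⟩
  rw [← taylor_injective t |>.eq_iff]
  ext n
  simp only [taylor_mul, taylor_C, taylor_pow, map_sub, taylor_X, add_sub_cancel_right,
    coeff_C_mul, coeff_X_pow]
  rcases lt_trichotomy n k with hn | rfl | hn
  · simp [hcoeff n hn, hn.ne]
  · simp
  · rw [coeff_eq_zero_of_natDegree_lt (by rw [natDegree_taylor]; omega), if_neg hn.ne', mul_zero]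

/-- The monomials and the truncated powers at the interior knots. -/
noncomputable def truncatedPower : Fin (k + 1) ⊕ Fin g → Set.Icc a b → ℝ
  | .inl r => fun x => (x : ℝ) ^ (r : ℕ)
  | .inr j => fun x => if T.clamped (j + 1) ≤ x then ((x : ℝ) - T.clamped (j + 1)) ^ k else 0

/-- Consecutive pieces agree to order k - 1 at their common knot, so they differ by a multiple of
the k-th power of the distance to it. Summing these jumps from the first piece gives the expansion.
-/
lemma splineSpace_le_span_truncatedPower :
    T.splineSpace ≤ Submodule.span ℝ (Set.range T.truncatedPower) := by
  rintro s ⟨p, hp1, hp2, hp3⟩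
  have hjump : ∀ j : ℕ, ∃ c : ℝ, j < g →
      p (j + 1) - p j = C c * (X - C (T.clamped (j + 1))) ^ k := fun j => by
    by_cases hj : j < g
    · obtain ⟨c, hc⟩ := exists_eq_C_mul_X_sub_C_pow (q := p (j + 1) - p j) (k := k)
        (t := T.clamped (j + 1))
        ((natDegree_sub_le_of_le (hp1 (j + 1) (by omega)) (hp1 j hj.le)).trans (by simp))
        (fun r hr => by
          rw [iterate_derivative_sub, eval_sub, sub_eq_zero,
            T.clamped_eq_knot (by omega) (by omega)]
          exact (hp3 j hj r hr).symm)
      exact ⟨c, fun _ => hc⟩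
    · exact ⟨0, fun h => absurd h hj⟩
  choose c hc using hjump
  have hpj : ∀ j ≤ g, p j = p 0 +
      ∑ i ∈ Finset.range j, C (c i) * (X - C (T.clamped (i + 1))) ^ k := fun j => by
    induction j with
    | zero => simp
    | succ j ih =>
      intro hj
      rw [Finset.sum_range_succ, ← add_assoc, ← ih (by omega), ← hc j hj, add_sub_cancel]
  have hs : s = ∑ r : Fin (k + 1), (p 0).coeff r • T.truncatedPower (.inl r) +
      ∑ i : Fin g, c i • T.truncatedPower (.inr i) := by
    ext x
    obtain ⟨j, hj, hx⟩ := T.exists_mem_cell x.2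
    rw [hp2 j hj x hx, hpj j hj]
    simp only [eval_add, eval_finsetSum, eval_mul, eval_C, eval_pow, eval_sub, eval_X,
      Pi.add_apply, Finset.sum_apply, Pi.smul_apply, smul_eq_mul, truncatedPower]
    congr 1
    · rw [eval_eq_sum_range' (n := k + 1) (by have := hp1 0 (by omega); omega), Finset.sum_range]
    · rw [← Finset.sum_range (fun i : ℕ => c i * if T.clamped (i + 1) ≤ x then
        ((x : ℝ) - T.clamped (i + 1)) ^ k else 0)]
      rw [← Finset.sum_subset (Finset.range_subset_range.mpr hj)]
      · refine Finset.sum_congr rfl fun i hi => ?_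
        rw [Finset.mem_range] at hi
        rw [if_pos]
        exact (T.clamped_monotone (by omega)).trans
          ((T.mem_cell_iff (by omega) (by omega)).mp hx).1
      · intro i hi hi'
        rw [Finset.mem_range] at hi hi'
        rw [if_neg, mul_zero]
        -- Later knots lie to the right of x; if x = b, the cell is the last one and no interior
        -- knot remains.
        rcases ((T.mem_cell_iff (by omega) (by omega)).mp hx).2 with h | h
        · exact not_le.mpr (h.trans_le (T.clamped_monotone (by omega)))
        · omega
  rw [hs]
  exact Submodule.add_mem _
    (Submodule.sum_mem _ fun r _ => Submodule.smul_mem _ _ (Submodule.subset_span ⟨_, rfl⟩))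
    (Submodule.sum_mem _ fun r _ => Submodule.smul_mem _ _ (Submodule.subset_span ⟨_, rfl⟩))

/-- The constant `1` together with the ZB-splines. -/
noncomputable def zbBasis : Option (Set.Ico (-(k : ℤ)) (g : ℤ)) → Set.Icc a b → ℝ :=
  fun o => Option.casesOn' o 1 fun i => T.zbSpline i

/-- The integral separates 1 from the span of the ZB-splines. -/
lemma linearIndependent_zbBasis : LinearIndependent ℝ T.zbBasis := by
  change LinearIndependent ℝ fun o : Option (Set.Ico (-(k : ℤ)) (g : ℤ)) =>
    Option.casesOn' o 1 fun i => T.zbSpline i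
  rw [linearIndependent_option']
  refine ⟨T.linearIndependent_zbSpline, fun h => ?_⟩
  have hle : Submodule.span ℝ (Set.range fun i : Set.Ico (-(k : ℤ)) (g : ℤ) => T.zbSpline i) ≤
      zeroIntegralSubmodule ((volume : Measure ℝ).comap Subtype.val) := by
    rw [Submodule.span_le]
    rintro _ ⟨i, rfl⟩
    exact T.zbSpline_mem_zeroIntegral i.2.1 i.2.2
  have h1 := (hle h).2
  have h2 := integral_subtype_comap (μ := volume) (measurableSet_Icc (a := a) (b := b))
    (fun _ => (1 : ℝ))
  simp only [Pi.one_apply] at h1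
  rw [h1] at h2
  simp [T.left_lt_right.le] at h2
  linarith [T.left_lt_right]

lemma span_zbBasis : Submodule.span ℝ (Set.range T.zbBasis) = T.splineSpace := by
  have hle : Submodule.span ℝ (Set.range T.zbBasis) ≤ T.splineSpace := by
    rw [Submodule.span_le]
    rintro _ ⟨_ | i, rfl⟩
    · exact T.one_mem_splineSpace
    · exact T.zbSpline_mem i.2.1 i.2.2
  have hfin : FiniteDimensional ℝ (Submodule.span ℝ (Set.range T.truncatedPower)) :=
    FiniteDimensional.span_of_finite ℝ (Set.finite_range _)
  have : FiniteDimensional ℝ T.splineSpace :=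
    Submodule.finiteDimensional_of_le T.splineSpace_le_span_truncatedPower
  refine Submodule.eq_of_le_of_finrank_le hle ?_
  rw [finrank_span_eq_card T.linearIndependent_zbBasis]
  refine (Submodule.finrank_mono T.splineSpace_le_span_truncatedPower).trans
    ((finrank_range_le_card _).trans ?_)
  simp
  omega

end ClampedKnots

/-! ### Products of function families -/

/-- For fixed y, independence of `u` kills each inner sum over j; letting y vary, independence of
`v` kills the coefficients. -/
lemma LinearIndependent.mul_prod {α β ι κ : Type*} {u : ι → α → ℝ} {v : κ → β → ℝ}
    [Finite ι] [Finite κ] (hu : LinearIndependent ℝ u) (hv : LinearIndependent ℝ v) :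
    LinearIndependent ℝ (fun (o : ι × κ) (p : α × β) => u o.1 p.1 * v o.2 p.2) := by
  have := Fintype.ofFinite ι
  have := Fintype.ofFinite κ
  rw [Fintype.linearIndependent_iff] at *
  intro c hc
  rintro ⟨i, j⟩
  refine hv (fun j => c (i, j)) ?_ j
  ext y
  simp only [Finset.sum_apply, Pi.smul_apply, smul_eq_mul, Pi.zero_apply]
  refine hu (fun i => ∑ j, c (i, j) * v j y) ?_ i
  ext x
  have h := congrFun hc (x, y)
  simp only [Finset.sum_apply, Pi.smul_apply, smul_eq_mul, Pi.zero_apply,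
    Fintype.sum_prod_type] at h ⊢
  rw [← h]
  refine Finset.sum_congr rfl fun i _ => ?_
  rw [Finset.sum_mul]
  exact Finset.sum_congr rfl fun j _ => by ring

lemma span_mul_prod {α β ι κ : Type*} (u : ι → α → ℝ) (v : κ → β → ℝ) :
    Submodule.span ℝ {f : α × β → ℝ | ∃ s ∈ Submodule.span ℝ (Set.range u),
      ∃ t ∈ Submodule.span ℝ (Set.range v), f = fun p => s p.1 * t p.2} =
    Submodule.span ℝ (Set.range fun (o : ι × κ) (p : α × β) => u o.1 p.1 * v o.2 p.2) := by
  let B : (α → ℝ) →ₗ[ℝ] (β → ℝ) →ₗ[ℝ] (α × β → ℝ) :=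
    LinearMap.mk₂ ℝ (fun s t p => s p.1 * t p.2)
      (fun _ _ _ => by ext; simp [add_mul]) (fun _ _ _ => by ext; simp [mul_assoc])
      (fun _ _ _ => by ext; simp [mul_add]) (fun _ _ _ => by ext; simp [mul_left_comm])
  have h1 : {f : α × β → ℝ | ∃ s ∈ Submodule.span ℝ (Set.range u),
      ∃ t ∈ Submodule.span ℝ (Set.range v), f = fun p => s p.1 * t p.2} =
      Set.image2 (fun s t => B s t) (Submodule.span ℝ (Set.range u) : Set (α → ℝ))
        (Submodule.span ℝ (Set.range v) : Set (β → ℝ)) := by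
    ext f
    simp only [Set.mem_ofPred_eq, Set.mem_image2, SetLike.mem_coe, eq_comm (b := f)]
    rfl
  have h2 : (Set.range fun (o : ι × κ) (p : α × β) => u o.1 p.1 * v o.2 p.2) =
      Set.image2 (fun s t => B s t) (Set.range u) (Set.range v) := by
    rw [Set.image2_range]
    rfl
  rw [h1, h2, ← Submodule.map₂_span_span, ← Submodule.map₂_span_span, Submodule.span_eq,
    Submodule.span_eq]

/-! ### The tensor-product basis and the zero-integral subspace -/

section Tensor

variable {k g l h : ℕ} {a b c d : ℝ} (T : ClampedKnots k g a b) (U : ClampedKnots l h c d)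

/-- The products of the members of the two bases `1, Z_i` and `1, Z_j`. -/
noncomputable def zbProduct :
    Option (Set.Ico (-(k : ℤ)) (g : ℤ)) × Option (Set.Ico (-(l : ℤ)) (h : ℤ)) →
      (Set.Icc a b × Set.Icc c d → ℝ) :=
  fun o p => T.zbBasis o.1 p.1 * U.zbBasis o.2 p.2

lemma span_zbProduct : Submodule.span ℝ (Set.range (zbProduct T U)) = tensorSplineSpace T U := by
  rw [tensorSplineSpace, ← T.span_zbBasis, ← U.span_zbBasis, span_mul_prod]
  rfl

/-- The index of a member of `zbFamily` in `zbProduct`. -/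
def zbIndex {ι κ : Type*} : (ι × κ) ⊕ ι ⊕ κ → Option ι × Option κ
  | .inl (i, j) => (some i, some j)
  | .inr (.inl i) => (some i, none)
  | .inr (.inr j) => (none, some j)

lemma zbIndex_injective {ι κ : Type*} : Function.Injective (zbIndex : (ι × κ) ⊕ ι ⊕ κ → _) := by
  rintro (⟨i, j⟩ | i | j) (⟨i', j'⟩ | i' | j') <;> simp [zbIndex]

lemma zbFamily_eq_comp : zbFamily T U = zbProduct T U ∘ zbIndex := by
  ext (⟨i, j⟩ | i | j) p <;> simp [zbFamily, zbIndex, zbProduct, ClampedKnots.zbBasis]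

lemma linearIndependent_zbFamily : LinearIndependent ℝ (zbFamily T U) := by
  rw [zbFamily_eq_comp]
  exact (T.linearIndependent_zbBasis.mul_prod U.linearIndependent_zbBasis).comp _ zbIndex_injective

lemma range_zbProduct : Set.range (zbProduct T U) = insert 1 (Set.range (zbFamily T U)) := by
  rw [zbFamily_eq_comp]
  ext f
  simp only [Set.mem_range, Set.mem_insert_iff, Function.comp_apply]
  have h1 : zbProduct T U (none, none) = 1 := by ext; simp [zbProduct, ClampedKnots.zbBasis]
  constructor
  · rintro ⟨⟨_ | i, _ | j⟩, rfl⟩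
    · exact Or.inl h1
    · exact Or.inr ⟨.inr (.inr j), rfl⟩
    · exact Or.inr ⟨.inr (.inl i), rfl⟩
    · exact Or.inr ⟨.inl (i, j), rfl⟩
  · rintro (rfl | ⟨o, rfl⟩)
    · exact ⟨_, h1⟩
    · exact ⟨_, rfl⟩

lemma zbFamily_mem_zeroIntegral (o) :
    zbFamily T U o ∈ zeroIntegralSubmodule (rectMeasure a b c d) := by
  have := isFiniteMeasure_comap_Icc a b
  have := isFiniteMeasure_comap_Icc c d
  have hZ := fun i : Set.Ico (-(k : ℤ)) (g : ℤ) => T.zbSpline_mem_zeroIntegral i.2.1 i.2.2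
  have hZ' := fun i : Set.Ico (-(l : ℤ)) (h : ℤ) => U.zbSpline_mem_zeroIntegral i.2.1 i.2.2
  rcases o with (⟨i, j⟩ | i | j)
  · refine ⟨(hZ i).1.mul_prod (hZ' j).1, ?_⟩
    simp only [zbFamily, rectMeasure]
    rw [integral_prod_mul, (hZ i).2, zero_mul]
  · refine ⟨((hZ i).1.mul_prod (integrable_const (1 : ℝ))).congr
      (Filter.Eventually.of_forall fun p => mul_one _), ?_⟩
    have := integral_prod_mul (μ := (volume : Measure ℝ).comap Subtype.val)
      (ν := (volume : Measure ℝ).comap (Subtype.val : Set.Icc c d → ℝ)) (T.zbSpline i) (fun _ => 1)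
    rw [(hZ i).2, zero_mul] at this
    simpa [zbFamily, rectMeasure] using this
  · refine ⟨((integrable_const (1 : ℝ)).mul_prod (hZ' j).1).congr
      (Filter.Eventually.of_forall fun p => one_mul _), ?_⟩
    have := integral_prod_mul (μ := (volume : Measure ℝ).comap (Subtype.val : Set.Icc a b → ℝ))
      (ν := (volume : Measure ℝ).comap Subtype.val) (fun _ => 1) (U.zbSpline j)
    rw [(hZ' j).2, mul_zero] at this
    simpa [zbFamily, rectMeasure] using this

lemma one_notMem_zeroIntegral (hab : a < b) (hcd : c < d) :
    (1 : Set.Icc a b × Set.Icc c d → ℝ) ∉ zeroIntegralSubmodule (rectMeasure a b c d) := by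
  have := isFiniteMeasure_comap_Icc a b
  have := isFiniteMeasure_comap_Icc c d
  rintro ⟨-, h⟩
  have hvol : ∀ a b : ℝ, ((volume : Measure ℝ).comap (Subtype.val : Set.Icc a b → ℝ)).real
      Set.univ = max (b - a) 0 := fun a b => by
    rw [Measure.real, comap_subtype_coe_apply measurableSet_Icc, Set.image_univ,
      Subtype.range_coe]
    simp [ENNReal.toReal_ofReal']
  have h2 := integral_prod_mul (μ := (volume : Measure ℝ).comap (Subtype.val : Set.Icc a b → ℝ))
      (ν := (volume : Measure ℝ).comap (Subtype.val : Set.Icc c d → ℝ))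
      (fun _ => (1 : ℝ)) (fun _ => (1 : ℝ))
  simp only [mul_one, Pi.one_apply, rectMeasure] at h h2
  rw [h, integral_const, integral_const, hvol, hvol, max_eq_left (by linarith),
    max_eq_left (by linarith)] at h2
  have := mul_pos (sub_pos.mpr hab) (sub_pos.mpr hcd)
  simp at h2
  rcases h2 with h2 | h2 <;> linarith

lemma span_zbFamily :
    Submodule.span ℝ (Set.range (zbFamily T U)) = zeroIntegralTensorSplineSpace T U := by
  have hle : Submodule.span ℝ (Set.range (zbFamily T U)) ≤
      zeroIntegralSubmodule (rectMeasure a b c d) := by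
    rw [Submodule.span_le]
    rintro _ ⟨o, rfl⟩
    exact zbFamily_mem_zeroIntegral T U o
  have htensor : tensorSplineSpace T U =
      Submodule.span ℝ (insert 1 (Set.range (zbFamily T U))) := by
    rw [← span_zbProduct, range_zbProduct]
  apply le_antisymm
  · intro f hf
    refine ⟨?_, hle hf⟩
    rw [htensor]
    exact Submodule.span_mono (Set.subset_insert _ _) hf
  · rintro f ⟨hf, hf0⟩
    rw [htensor, Submodule.mem_span_insert] at hf
    obtain ⟨r, z, hz, rfl⟩ := hf
    -- Subtracting the part `z` of integral zero leaves a constant of integral zero, so r = 0.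
    have h1 : r • (1 : Set.Icc a b × Set.Icc c d → ℝ) ∈
        zeroIntegralSubmodule (rectMeasure a b c d) := by
      have := Submodule.sub_mem _ (show _ ∈ zeroIntegralSubmodule _ from hf0) (hle hz)
      rwa [add_sub_cancel_right] at this
    obtain rfl : r = 0 := by
      by_contra hr
      refine one_notMem_zeroIntegral T.left_lt_right U.left_lt_right ?_
      simpa [smul_smul, hr] using Submodule.smul_mem _ r⁻¹ h1
    simpa using hz

end Tensor

theorem theorem3 (k g l h : ℕ) (a b c d : ℝ)
    (T : ClampedKnots k g a b) (U : ClampedKnots l h c d) :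
    LinearIndependent ℝ (zbFamily T U) ∧
    Submodule.span ℝ (Set.range (zbFamily T U)) = zeroIntegralTensorSplineSpace T U ∧
    Module.finrank ℝ (zeroIntegralTensorSplineSpace T U) = (g + k + 1) * (h + l + 1) - 1 ∧
    (g + k + 1) * (h + l + 1) - 1 = (g + k) * (h + l) + g + k + h + l := by
  have hnum : (g + k + 1) * (h + l + 1) - 1 = (g + k) * (h + l) + g + k + h + l := by
    rw [show (g + k + 1) * (h + l + 1) = (g + k) * (h + l) + g + k + h + l + 1 by ring,
      Nat.add_sub_cancel]
  refine ⟨linearIndependent_zbFamily T U, span_zbFamily T U, ?_, hnum⟩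
  rw [hnum, ← span_zbFamily, finrank_span_eq_card (linearIndependent_zbFamily T U)]
  have hk : ((g : ℤ) + k).toNat = g + k := by omega
  have hl : ((h : ℤ) + l).toNat = h + l := by omega
  simp [hk, hl]
  ring
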